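/- Let $\mathcal X$ be a measurable space, let $n,B\in\mathbb N$ with $B\ge 1$ and $n\ge 2B$, let $g:\mathcal X\to[0,1]$ be measurable, and let $P$ be a probability distribution on $\mathcal X\times[0,1]$ (binary labels in $\{0,1\}$ being a special case). Let $(X,Y)\sim P$ and let $\mathcal D_n=((X_1,Y_1),\dots,(X_n,Y_n))$ consist of $n$ independent draws from $P$. Assume that the law of $g(X)$ is absolutely continuous with respect to Lebesgue measure. UMD (uniform-mass binning without sample splitting) maps $(g,\mathcal D_n)$ to the following predictor $h:\mathcal X\to[0,1]$. Put $S_i=g(X_i)$, let $S_{(1)}\le\dots\le S_{(n)}$ be the order statistics of the $S_i$ (ties broken by index), let $Y_{(1)},\dots,Y_{(n)}$ be the labels in the corresponding order, and put $S_{(0)}=0$, $S_{(n+1)}=1$. For $b=0,\dots,B$ put $A_b=\lceil b(n+1)/B\rceil$. For $b=1,\dots,B$ let $\widehat\Pi_b$ be the mean of $Y_{(A_{b-1}+1)},\dots,Y_{(A_b-1)}$. Then $$h(x)=\sum_{b=1}^{B}\mathbf 1\{S_{(A_{b-1})}\le g(x)<S_{(A_b)}\}\,\widehat\Pi_b .$$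 Let $\alpha\in(0,1)$ and $$\varepsilon=\sqrt{\frac{\log(2B/\alpha)}{2(\lfloor n/B\rfloor-1)}} .$$ Then UMD is $(\varepsilon,\alpha)$-conditionally calibrated (for every such $g$ and $P$): with probability at least $1-\alpha$ over $\mathcal D_n$, $$\bigl|\mathbb E[Y\mid h(X)=r]-r\bigr|\le\varepsilon\quad\text{for all } r\in\mathrm{Range}(h),$$ where $(X,Y)\sim P$ is independent of $\mathcal D_n$, $h$ is held fixed in the conditional expectation, and $r\mapsto\mathbb E[Y\mid h(X)=r]$ denotes a suitable version of the regression function of $Y$ on $h(X)$ (so values $r$ with $\Pr(h(X)=r)=0$, at which it is not determined, impose no condition). Moreover, with probability at least $1-\alpha$ over $\mathcal D_n$, for all $p\in[1,\infty)$ simultaneously, $$\ell_p\text{-ECE}(h):=\Bigl(\mathbb E_X\bigl|\mathbb E[Y\mid h(X)]-h(X)\bigr|^p\Bigr)^{1/p}\le\varepsilon .$$ -/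

import Mathlib

open MeasureTheory ProbabilityTheory

noncomputable section

namespace UMD

/-- The space of predictors: measurable functions `𝒳 → [0, 1]`. -/
abbrev Predictor (𝒳 : Type*) [MeasurableSpace 𝒳] : Type _ :=
  {g : 𝒳 → unitInterval // Measurable g}

/-- A calibrator: it maps a predictor and `n` labelled points to a new predictor. -/
abbrev Calibrator (𝒳 : Type*) [MeasurableSpace 𝒳] (n : ℕ) : Type _ :=
  Predictor 𝒳 → (Fin n → 𝒳 × unitInterval) → Predictor 𝒳

/-- `Q` holds with probability at least `q`: it holds on a measurable event of probability
at least `q`. -/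
def WithProbAtLeast {Ω : Type*} [MeasurableSpace Ω] (μ : Measure Ω) (q : ℝ) (Q : Ω → Prop) :
    Prop :=
  ∃ E : Set Ω, MeasurableSet E ∧ ENNReal.ofReal q ≤ μ E ∧ ∀ ω ∈ E, Q ω

section Calibration

variable {𝒳 : Type*} [MeasurableSpace 𝒳]

/-- The random variable `E[Y | h(X)]` for `(X, Y) ∼ P`. -/
def condLabel (P : Measure (𝒳 × unitInterval)) (h : Predictor 𝒳) : 𝒳 × unitInterval → ℝ :=
  P[fun z => (z.2 : ℝ) | MeasurableSpace.comap (fun z : 𝒳 × unitInterval => h.1 z.1) inferInstance]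

/-- `m` is a version of the regression function `r ↦ E[Y | h(X) = r]`. It is determined up to null
sets of the law of `h(X)`; in particular `m r` is the elementary conditional expectation
whenever `P(h(X) = r) > 0`. -/
def IsRegressionFunction (P : Measure (𝒳 × unitInterval)) (h : Predictor 𝒳)
    (m : unitInterval → ℝ) : Prop :=
  Measurable m ∧ (fun z : 𝒳 × unitInterval => m (h.1 z.1)) =ᵐ[P] condLabel P h

/-- The deterministic property `∀ r ∈ Range(h), |E[Y | h(X) = r] - r| ≤ ε` of a predictor `h`. -/
def IsCalibratedPredictor (P : Measure (𝒳 × unitInterval)) (h : Predictor 𝒳) (ε : ℝ) : Prop :=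
  ∃ m : unitInterval → ℝ, IsRegressionFunction P h m ∧ ∀ r ∈ Set.range h.1, |m r - (r : ℝ)| ≤ ε

/-- The law of the calibration data: `n` independent draws from `P`. -/
def dataLaw (P : Measure (𝒳 × unitInterval)) (n : ℕ) : Measure (Fin n → 𝒳 × unitInterval) :=
  Measure.pi fun _ => P

/-- `(ε, α)`-conditional calibration of `H` for the predictor `g` and the distribution `P`. -/
def ConditionallyCalibratedAt {n : ℕ} (H : Calibrator 𝒳 n) (g : Predictor 𝒳)
    (P : Measure (𝒳 × unitInterval)) (ε α : ℝ) : Prop :=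
  WithProbAtLeast (dataLaw P n) (1 - α) fun D => IsCalibratedPredictor P (H g D) ε

/-- The `ℓ_p` expected calibration error `(E |E[Y | h(X)] - h(X)|^p)^(1/p)`. -/
def ece (P : Measure (𝒳 × unitInterval)) (p : ℝ) (h : Predictor 𝒳) : ENNReal :=
  (∫⁻ z, ENNReal.ofReal (|condLabel P h z - (h.1 z.1 : ℝ)| ^ p) ∂P) ^ (1 / p)

end Calibration

section Algorithm

/-- The array entry `A_b = ⌈b Δ⌉` with `Δ = (n + 1) / B`, for `b = 0, …, B`. -/
def cut (n B b : ℕ) : ℕ := ⌈(b : ℝ) * (((n : ℝ) + 1) / B)⌉₊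

/-- The order statistics `S_(1) ≤ … ≤ S_(n)` of `s`, with `S_(0) = 0` and `S_(n+1) = 1`. Here
`Tuple.sort s` is the permutation that sorts `s`, the ranks being counted from `0`. -/
def orderStat {n : ℕ} (s : Fin n → unitInterval) (i : ℕ) : unitInterval :=
  if i = 0 then 0 else if hi : i - 1 < n then s (Tuple.sort s ⟨i - 1, hi⟩) else 1

/-- The positions strictly between `A_b` and `A_{b+1}`; `i : Fin n` stands for the rank `i + 1`. -/
def innerRanks (n B b : ℕ) : Finset (Fin n) :=
  {i : Fin n | cut n B b < i.1 + 1 ∧ i.1 + 1 < cut n B (b + 1)}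

/-- The bin mean `Mean(Y_(l+1), …, Y_(u-1))` with `l = A_b` and `u = A_{b+1}`; the labels
are ordered as the scores are. -/
def binMean {n : ℕ} (B : ℕ) (s y : Fin n → unitInterval) (b : ℕ) : ℝ :=
  (∑ i ∈ innerRanks n B b, (y (Tuple.sort s i) : ℝ)) / (innerRanks n B b).card

/-- The value of the recalibrated predictor at a point with score `t`:
`∑_b 1{S_(A_b) ≤ t < S_(A_{b+1})} · (mean of bin b)`, with bins `b = 0, …, B - 1`. -/
def binnedValue {n : ℕ} (B : ℕ) (s y : Fin n → unitInterval) (t : unitInterval) : ℝ :=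
  ∑ b ∈ Finset.range B,
    if orderStat s (cut n B b) ≤ t ∧ t < orderStat s (cut n B (b + 1)) then binMean B s y b else 0

theorem cut_mono (n B : ℕ) : Monotone (cut n B) := by
  intro a b hab
  unfold cut
  gcongr

theorem orderStat_mono {n : ℕ} (s : Fin n → unitInterval) : Monotone (orderStat s) := by
  intro i j hij
  unfold orderStat
  by_cases hi : i = 0
  · simp [hi]
  have hj : j ≠ 0 := by omega
  simp only [hi, hj, if_false]
  by_cases hjn : j - 1 < n
  · have hin : i - 1 < n := by omega
    simp only [hin, hjn, dif_pos]
    exact Tuple.monotone_sort s (by simp only [Fin.mk_le_mk]; omega)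
  · simp only [hjn, dif_neg, not_false_eq_true]
    exact le_top

theorem binMean_mem {n : ℕ} (B : ℕ) (s y : Fin n → unitInterval) (b : ℕ) :
    binMean B s y b ∈ Set.Icc (0 : ℝ) 1 := by
  unfold binMean
  refine ⟨div_nonneg (Finset.sum_nonneg fun i _ => (y _).2.1) (Nat.cast_nonneg _),
    div_le_one_of_le₀ ?_ (Nat.cast_nonneg _)⟩
  calc _ ≤ ∑ _i ∈ innerRanks n B b, (1 : ℝ) := Finset.sum_le_sum fun i _ => (y _).2.2
    _ = _ := by simp

theorem binnedValue_mem {n : ℕ} (B : ℕ) (s y : Fin n → unitInterval) (t : unitInterval) :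
    binnedValue B s y t ∈ Set.Icc (0 : ℝ) 1 := by
  unfold binnedValue
  by_cases h : ∃ b ∈ Finset.range B,
      orderStat s (cut n B b) ≤ t ∧ t < orderStat s (cut n B (b + 1))
  · obtain ⟨b, hb, h1, h2⟩ := h
    rw [Finset.sum_eq_single_of_mem b hb, if_pos ⟨h1, h2⟩]
    · exact binMean_mem B s y b
    · intro c _ hcb
      refine if_neg ?_
      rintro ⟨h3, h4⟩
      rcases lt_or_gt_of_ne hcb with hlt | hlt
      · exact absurd (h4.trans_le ((orderStat_mono s (cut_mono n B hlt)).trans h1)) (lt_irrefl _)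
      · exact absurd (h2.trans_le ((orderStat_mono s (cut_mono n B hlt)).trans h3)) (lt_irrefl _)
  · rw [Finset.sum_eq_zero]
    · simp
    · exact fun b hb => if_neg fun hc => h ⟨b, hb, hc⟩

theorem measurable_binnedValue {n : ℕ} (B : ℕ) (s y : Fin n → unitInterval) :
    Measurable (binnedValue B s y) := by
  unfold binnedValue
  refine Finset.measurable_sum _ fun b _ => Measurable.ite ?_ measurable_const measurable_const
  exact measurableSet_Ico

/-- Uniform-mass binning without sample splitting, with `B` bins. -/
def umd {𝒳 : Type*} [MeasurableSpace 𝒳] (n B : ℕ) : Calibrator 𝒳 n := fun g D =>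
  ⟨fun x => ⟨binnedValue B (fun i => g.1 (D i).1) (fun i => (D i).2) (g.1 x),
    binnedValue_mem B _ _ _⟩,
    ((measurable_binnedValue B _ _).comp g.2).subtype_mk⟩

end Algorithm

end UMD

end

open MeasureTheory ProbabilityTheory

namespace UMD

/-! ### Order statistics under changes of the inner points of a bin. -/

section OrderStatistics

variable {n : ℕ}

/-! The same data choose the bin edges and supply the labels, but the points at the edges are left
out of the bin means. This makes the inner labels independent given the edges.

Fix a bin with edge ranks `l < u` and a set `T` of indices, and freeze the points outside `T`. If
the scores in `T` can lie strictly between the two edges at all, then the edges are determined by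
the frozen points, and the event `Enclosed l u T` says exactly that every point of `T` falls into
one fixed band (`Enclosed.orderStat_eq`, `Enclosed.of_forall_mem`). On this event the points of `T`
are independent draws from `P` conditioned on the band, so Hoeffding's inequality bounds a deviation
by `2 exp(-2Nε²)` times the probability of the event (`dataLaw_enclosed_deviates_le`). Scores almost
surely have no ties, and for different `T` of the right size the events are disjoint, so summing
over `T` costs nothing (`dataLaw_deviates_le`).

Each bin has `N ≥ ⌊n/B⌋ - 1` inner points, and `ε` is chosen so that a union bound over `B` bins
gives `α`. Outside the bad event, level sets of `h` are, up to null sets, unions of bins, so the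
bound passes from bins to `E[Y | h(X)]`, and then to the calibration error. -/

theorem orderStat_zero (s : Fin n → unitInterval) : orderStat s 0 = 0 := by
  simp [orderStat]

theorem orderStat_rank (s : Fin n → unitInterval) (i : Fin n) :
    orderStat s (i.1 + 1) = s (Tuple.sort s i) := by
  simp [orderStat]

theorem orderStat_eq_one (s : Fin n → unitInterval) {i : ℕ} (hi : n < i) :
    orderStat s i = 1 := by
  have h0 : i ≠ 0 := by omega
  have h1 : ¬ i - 1 < n := by omega
  simp [orderStat, h0, h1]

/-- Counting eliminates the sorting permutation, so that order statistics of two samples can be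
compared and measurability becomes visible. -/
theorem orderStat_le_iff (s : Fin n → unitInterval) {i : ℕ} (h1 : 1 ≤ i) (hn : i ≤ n)
    (t : unitInterval) :
    orderStat s i ≤ t ↔ i ≤ (Finset.univ.filter fun k => s k ≤ t).card := by
  constructor
  · intro h
    have hsub : (Finset.univ.filter fun j : Fin n => j.1 < i).map (Tuple.sort s).toEmbedding ⊆
        Finset.univ.filter fun k => s k ≤ t := by
      intro k hk
      simp only [Finset.mem_map, Finset.mem_filter, Finset.mem_univ, true_and,
        Equiv.coe_toEmbedding] at hk ⊢
      obtain ⟨j, hj, rfl⟩ := hk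
      rw [← orderStat_rank s]
      exact (orderStat_mono s hj).trans h
    have := Finset.card_le_card hsub
    rwa [Finset.card_map, Fin.card_filter_val_lt, min_eq_right hn] at this
  · intro h
    by_contra hlt
    rw [not_le] at hlt
    have hsub : (Finset.univ.filter fun k => s k ≤ t) ⊆
        (Finset.univ.filter fun j : Fin n => j.1 < i - 1).map (Tuple.sort s).toEmbedding := by
      intro k hk
      simp only [Finset.mem_map, Finset.mem_filter, Finset.mem_univ, true_and,
        Equiv.coe_toEmbedding] at hk ⊢
      refine ⟨(Tuple.sort s).symm k, ?_, by simp⟩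
      by_contra hge
      have h2 := orderStat_mono s (show i ≤ ((Tuple.sort s).symm k).1 + 1 by omega)
      rw [orderStat_rank, Equiv.apply_symm_apply] at h2
      exact absurd (hlt.trans_le (h2.trans hk)) (lt_irrefl _)
    have := h.trans (Finset.card_le_card hsub)
    rw [Finset.card_map, Fin.card_filter_val_lt] at this
    omega

theorem orderStat_lt_iff (s : Fin n → unitInterval) {i : ℕ} (h1 : 1 ≤ i) (hn : i ≤ n)
    (t : unitInterval) :
    orderStat s i < t ↔ i ≤ (Finset.univ.filter fun k => s k < t).card := by
  constructor
  · intro h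
    refine ((orderStat_le_iff s h1 hn _).1 le_rfl).trans (Finset.card_le_card ?_)
    intro k hk
    simp only [Finset.mem_filter, Finset.mem_univ, true_and] at hk ⊢
    exact hk.trans_lt h
  · intro h
    by_contra hge
    rw [not_lt] at hge
    have hne : (Finset.univ.filter fun k => s k < t).Nonempty :=
      Finset.card_pos.1 (by omega)
    obtain ⟨m, hm, hmax⟩ := Finset.exists_max_image _ s hne
    -- `s m` is the largest score below `t`, so every score below `t` is at most `s m`.
    have := (orderStat_le_iff s h1 hn (s m)).2 (h.trans (Finset.card_le_card fun k hk => by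
      have := hmax k hk
      simp only [Finset.mem_filter, Finset.mem_univ, true_and]
      exact this))
    simp only [Finset.mem_filter, Finset.mem_univ, true_and] at hm
    exact absurd (hm.trans_le (hge.trans this)) (lt_irrefl _)

/-- All scores with index in `T` lie strictly between the order statistics `l` and `u`. -/
def Enclosed (l u : ℕ) (T : Finset (Fin n)) (s : Fin n → unitInterval) : Prop :=
  ∀ k ∈ T, s k ∈ Set.Ioo (orderStat s l) (orderStat s u)

variable {l u : ℕ} {T : Finset (Fin n)} {s s' : Fin n → unitInterval}

/-- At least `l` scores of `s` are at most its lower edge. None of them has its index in `T`, so all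
of them survive in `s'`. -/
theorem Enclosed.orderStat_lower_le (hs : Enclosed l u T s) (h : ∀ k ∉ T, s' k = s k)
    (hl : l ≤ n) : orderStat s' l ≤ orderStat s l := by
  rcases Nat.eq_zero_or_pos l with rfl | h1
  · simp [orderStat_zero]
  rw [orderStat_le_iff s' h1 hl]
  refine ((orderStat_le_iff s h1 hl _).1 le_rfl).trans (Finset.card_le_card fun k hk => ?_)
  simp only [Finset.mem_filter, Finset.mem_univ, true_and] at hk ⊢
  rwa [h k fun hT => absurd ((hs k hT).1.trans_le hk) (lt_irrefl _)]

/-- If the upper edge dropped, at least `u` scores of `s'` would lie below the old edge. The same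
indices would give `u` scores of `s` strictly below its own `u`-th order statistic. -/
theorem Enclosed.le_orderStat_upper (hs : Enclosed l u T s) (h : ∀ k ∉ T, s' k = s k)
    (hu : 1 ≤ u) : orderStat s u ≤ orderStat s' u := by
  rcases lt_or_ge n u with hn | hn
  · simp [orderStat_eq_one _ hn]
  by_contra hlt
  rw [not_le, orderStat_lt_iff s' hu hn] at hlt
  refine absurd ((orderStat_lt_iff s hu hn (orderStat s u)).2
    (hlt.trans (Finset.card_le_card fun k hk => ?_))) (lt_irrefl _)
  simp only [Finset.mem_filter, Finset.mem_univ, true_and] at hk ⊢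
  by_cases hT : k ∈ T
  · exact (hs k hT).2
  · rwa [← h k hT]

/-- Changing the scores in `T` can only widen the gap between the edges, so scores placed in the old
gap lie in the new one. -/
theorem Enclosed.of_forall_mem (hs : Enclosed l u T s) (h : ∀ k ∉ T, s' k = s k)
    (hl : l ≤ n) (hu : 1 ≤ u)
    (hm : ∀ k ∈ T, s' k ∈ Set.Ioo (orderStat s l) (orderStat s u)) : Enclosed l u T s' :=
  fun k hk => ⟨(hs.orderStat_lower_le h hl).trans_lt (hm k hk).1,
    (hm k hk).2.trans_le (hs.le_orderStat_upper h hu)⟩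

/-- The gap widens weakly in both directions between `s` and `s'`. Hence the edges depend only on
the scores outside `T`. -/
theorem Enclosed.orderStat_eq (hs : Enclosed l u T s) (hs' : Enclosed l u T s')
    (h : ∀ k ∉ T, s' k = s k) (hl : l ≤ n) (hu : 1 ≤ u) :
    orderStat s' l = orderStat s l ∧ orderStat s' u = orderStat s u := by
  have h' : ∀ k ∉ T, s k = s' k := fun k hk => (h k hk).symm
  exact ⟨le_antisymm (hs.orderStat_lower_le h hl) (hs'.orderStat_lower_le h' hl),
    le_antisymm (hs'.le_orderStat_upper h' hu) (hs.le_orderStat_upper h hu)⟩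

/-- The ranks strictly between `l` and `u`; `i : Fin n` stands for the rank `i + 1`. -/
def ranksBetween (n l u : ℕ) : Finset (Fin n) :=
  {i : Fin n | l < i.1 + 1 ∧ i.1 + 1 < u}

theorem card_ranksBetween (hu : u ≤ n + 1) : (ranksBetween n l u).card = u - l - 1 := by
  have h : (ranksBetween n l u).map Fin.valEmbedding = Finset.Ico l (u - 1) := by
    ext x
    simp only [ranksBetween, Finset.mem_map, Finset.mem_filter, Finset.mem_univ, true_and,
      Fin.valEmbedding_apply, Finset.mem_Ico]
    constructor
    · rintro ⟨i, hi, rfl⟩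
      omega
    · intro hx
      exact ⟨⟨x, by omega⟩, by simp only; omega, rfl⟩
  rw [← Finset.card_map Fin.valEmbedding, h, Nat.card_Ico]
  omega

/-- Enclosed indices have inner ranks, and equal cardinality forces equality. Thus `s` determines
`T`, which makes the events for different `T` disjoint. -/
theorem Enclosed.eq_map_sort (hs : Enclosed l u T s)
    (hT : T.card = (ranksBetween n l u).card) :
    T = (ranksBetween n l u).map (Tuple.sort s).toEmbedding := by
  refine Finset.eq_of_subset_of_card_le (fun k hk => ?_) (by rw [Finset.card_map, hT])
  simp only [ranksBetween, Finset.mem_map, Finset.mem_filter, Finset.mem_univ, true_and,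
    Equiv.coe_toEmbedding]
  have hr := orderStat_rank s ((Tuple.sort s).symm k)
  rw [Equiv.apply_symm_apply] at hr
  refine ⟨(Tuple.sort s).symm k, ⟨?_, ?_⟩, by simp⟩
  · by_contra hc
    have := orderStat_mono s (not_lt.1 hc)
    rw [hr] at this
    exact absurd ((hs k hk).1.trans_le this) (lt_irrefl _)
  · by_contra hc
    have := orderStat_mono s (not_lt.1 hc)
    rw [hr] at this
    exact absurd ((hs k hk).2.trans_le this) (lt_irrefl _)

theorem orderStat_lt_orderStat (hinj : Function.Injective s)
    (h0 : ∀ k, s k ≠ 0) (h1 : ∀ k, s k ≠ 1) {i j : ℕ} (hij : i < j) (hj : j ≤ n + 1)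
    (hne : 0 < i ∨ j ≤ n) : orderStat s i < orderStat s j := by
  refine lt_of_le_of_ne (orderStat_mono s hij.le) fun heq => ?_
  rcases Nat.eq_zero_or_pos i with rfl | hi
  · have := orderStat_rank s ⟨j - 1, by omega⟩
    simp only [Nat.sub_add_cancel hij] at this
    rw [orderStat_zero, this] at heq
    exact h0 _ heq.symm
  · have hr := orderStat_rank s ⟨i - 1, by omega⟩
    simp only [Nat.sub_add_cancel hi] at hr
    rcases Nat.lt_or_ge n j with hjn | hjn
    · rw [orderStat_eq_one s hjn, hr] at heq
      exact h1 _ heq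
    · have hr' := orderStat_rank s ⟨j - 1, by omega⟩
      simp only [Nat.sub_add_cancel (show 1 ≤ j by omega)] at hr'
      rw [hr, hr'] at heq
      have := (Tuple.sort s).injective (hinj heq)
      simp only [Fin.mk.injEq] at this
      omega

theorem enclosed_map_sort (hinj : Function.Injective s)
    (h0 : ∀ k, s k ≠ 0) (h1 : ∀ k, s k ≠ 1) (hu : u ≤ n + 1) :
    Enclosed l u ((ranksBetween n l u).map (Tuple.sort s).toEmbedding) s := by
  intro k hk
  simp only [ranksBetween, Finset.mem_map, Finset.mem_filter, Finset.mem_univ, true_and,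
    Equiv.coe_toEmbedding] at hk
  obtain ⟨i, hi, rfl⟩ := hk
  rw [← orderStat_rank s]
  have := i.2
  exact ⟨orderStat_lt_orderStat hinj h0 h1 hi.1 (by omega) (by omega),
    orderStat_lt_orderStat hinj h0 h1 hi.2 hu (by omega)⟩

theorem measurable_orderStat (i : ℕ) :
    Measurable fun s : Fin n → unitInterval => orderStat s i := by
  rcases Nat.eq_zero_or_pos i with rfl | h1
  · simp only [orderStat_zero, measurable_const]
  rcases lt_or_ge n i with hn | hn
  · simp only [orderStat_eq_one _ hn, measurable_const]
  refine measurable_of_Iic fun t => ?_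
  have h : (fun s : Fin n → unitInterval => orderStat s i) ⁻¹' Set.Iic t =
      {s | i ≤ ∑ k, if s k ≤ t then 1 else 0} := by
    ext s
    rw [Set.mem_preimage, Set.mem_Iic, orderStat_le_iff s h1 hn, Finset.card_filter]
    rfl
  rw [h]
  refine measurableSet_le measurable_const (Finset.measurable_sum _ fun k _ => ?_)
  exact Measurable.ite (measurableSet_le (measurable_pi_apply k) measurable_const)
    measurable_const measurable_const

end OrderStatistics

/-! ### Hoeffding's inequality, plain and conditioned on a set. -/

section Hoeffding

variable {Z : Type*} [MeasurableSpace Z] {ι : Type*} [Fintype ι]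

/-- The two-sided **Hoeffding inequality** for independent draws of a `[0, 1]`-valued variable. -/
theorem measure_pi_abs_sum_sub_ge_le (Q : Measure Z) [IsProbabilityMeasure Q] {f : Z → ℝ}
    (hf : Measurable f) (hf01 : ∀ z, f z ∈ Set.Icc (0 : ℝ) 1) {ε : ℝ} (hε : 0 ≤ ε) :
    Measure.pi (fun _ : ι => Q)
        {v | Fintype.card ι * ε ≤ |∑ i, (f (v i) - ∫ z, f z ∂Q)|} ≤
      ENNReal.ofReal (2 * Real.exp (-2 * Fintype.card ι * ε ^ 2)) := by
  set N : ℝ := (Fintype.card ι : ℝ) with hN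
  have hN0 : 0 ≤ N := Nat.cast_nonneg _
  set μ := Measure.pi (fun _ : ι => Q)
  have hsub : ∀ i : ι, HasSubgaussianMGF (fun v : ι → Z => f (v i) - ∫ z, f z ∂Q)
      ((‖(1 : ℝ) - 0‖₊ / 2) ^ 2) μ := by
    intro i
    have h := hasSubgaussianMGF_of_mem_Icc (μ := μ) (X := fun v : ι → Z => f (v i)) (a := 0)
      (b := 1) (hf.comp (measurable_pi_apply i)).aemeasurable (ae_of_all _ fun v => hf01 (v i))
    have hi : ∫ v, f (v i) ∂μ = ∫ z, f z ∂Q := by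
      have hmp := measurePreserving_eval (fun _ : ι => Q) i
      rw [← hmp.map_eq, integral_map hmp.measurable.aemeasurable hf.aestronglyMeasurable]
    rwa [hi] at h
  have hind : iIndepFun (fun (i : ι) (v : ι → Z) => f (v i) - ∫ z, f z ∂Q) μ :=
    iIndepFun_pi (X := fun _ z => f z - ∫ z, f z ∂Q)
      fun _ => (hf.sub_const _).aemeasurable
  have hneg : iIndepFun (fun (i : ι) (v : ι → Z) => -(f (v i) - ∫ z, f z ∂Q)) μ :=
    iIndepFun_pi (X := fun _ z => -(f z - ∫ z, f z ∂Q))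
      fun _ => (hf.sub_const _).neg.aemeasurable
  have hNε : 0 ≤ N * ε := mul_nonneg hN0 hε
  have h1 := HasSubgaussianMGF.measure_sum_ge_le_of_iIndepFun hind (s := Finset.univ)
    (fun i _ => hsub i) hNε
  have h2 := HasSubgaussianMGF.measure_sum_ge_le_of_iIndepFun hneg (s := Finset.univ)
    (fun i _ => (hsub i).neg) hNε
  -- Each variable has sub-Gaussian parameter 1/4, so the exponent is `-(Nε)² / (2N/4)`. For `N = 0`
  -- both sides vanish since division by zero gives zero.
  have hexp : -(N * ε) ^ 2 / (2 * ((∑ _i : ι, ((‖(1 : ℝ) - 0‖₊ / 2) ^ 2 : NNReal) : NNReal) : ℝ)) =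
      -2 * N * ε ^ 2 := by
    rcases hN0.eq_or_lt with h0 | h0
    · simp [← h0]
    · simp only [sub_zero, nnnorm_one, Finset.sum_const, Finset.card_univ, nsmul_eq_mul]
      push_cast
      rw [← hN]
      field_simp
  push_cast at h1 h2 hexp
  rw [hexp] at h1 h2
  have hset : {v : ι → Z | N * ε ≤ |∑ i, (f (v i) - ∫ z, f z ∂Q)|} ⊆
      {v | N * ε ≤ ∑ i, (f (v i) - ∫ z, f z ∂Q)} ∪
      {v | N * ε ≤ ∑ i, -(f (v i) - ∫ z, f z ∂Q)} := by
    intro v hv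
    rw [Set.mem_ofPred_eq, le_abs, ← Finset.sum_neg_distrib] at hv
    exact hv
  refine (measure_mono hset).trans ((measure_union_le _ _).trans ?_)
  rw [two_mul, ENNReal.ofReal_add (Real.exp_nonneg _) (Real.exp_nonneg _)]
  gcongr
  · exact (ENNReal.le_ofReal_iff_toReal_le (measure_ne_top _ _) (Real.exp_nonneg _)).2 h1
  · exact (ENNReal.le_ofReal_iff_toReal_le (measure_ne_top _ _) (Real.exp_nonneg _)).2 h2

/-- On boxes, each factor satisfies `P (A ∩ s) = P A * P[s|A]`. Draws that all land in `A` are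
therefore independent draws from the conditional law. -/
theorem restrict_pi_eq_smul_pi_cond (P : Measure Z) [IsProbabilityMeasure P] {A : Set Z}
    (hA : P A ≠ 0) :
    (Measure.pi fun _ : ι => P).restrict (Set.univ.pi fun _ => A) =
      P A ^ Fintype.card ι • Measure.pi fun _ : ι => P[|A] := by
  have := cond_isProbabilityMeasure hA
  rw [Measure.restrict_pi_pi]
  refine Measure.pi_eq fun s _ => ?_
  rw [Measure.smul_apply, Measure.pi_pi, smul_eq_mul, ← Finset.card_univ, ← Finset.prod_const,
    ← Finset.prod_mul_distrib]
  refine Finset.prod_congr rfl fun i _ => ?_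
  rw [ProbabilityTheory.cond, Measure.smul_apply, smul_eq_mul, ← mul_assoc,
    ENNReal.mul_inv_cancel hA (measure_ne_top _ _), one_mul]

/-- Hoeffding's inequality for draws that all fall into `A`, relative to the conditional
mean on `A`. -/
theorem measure_pi_inter_deviation_le [Nonempty ι] (P : Measure Z) [IsProbabilityMeasure P]
    {f : Z → ℝ} (hf : Measurable f) (hf01 : ∀ z, f z ∈ Set.Icc (0 : ℝ) 1) {A : Set Z}
    {ε : ℝ} (hε : 0 ≤ ε) :
    Measure.pi (fun _ : ι => P)
        {v | (∀ i, v i ∈ A) ∧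
          ε * P.real A < |∫ z in A, (f z - (∑ i, f (v i)) / Fintype.card ι) ∂P|} ≤
      ENNReal.ofReal (2 * Real.exp (-2 * Fintype.card ι * ε ^ 2)) *
        Measure.pi (fun _ : ι => P) {v | ∀ i, v i ∈ A} := by
  have hpi : {v : ι → Z | ∀ i, v i ∈ A} = Set.univ.pi fun _ => A := by
    ext v; simp
  have hfP : Integrable f P := Integrable.of_mem_Icc 0 1 hf.aemeasurable (ae_of_all _ hf01)
  -- Conditioning on `A` needs positive mass; otherwise both sides are zero.
  by_cases h0 : P A = 0
  · have hz : Measure.pi (fun _ : ι => P) {v | ∀ i, v i ∈ A} = 0 := by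
      rw [hpi, Measure.pi_pi]
      simp [h0]
    rw [hz, mul_zero]
    exact (measure_mono_null (fun v hv => hv.1) hz).le
  have hc := cond_isProbabilityMeasure h0
  have hpos : 0 < P.real A := ENNReal.toReal_pos h0 (measure_ne_top _ _)
  have hN : (0 : ℝ) < Fintype.card ι := by exact_mod_cast Fintype.card_pos
  have hmean : ∫ z, f z ∂P[|A] = (P.real A)⁻¹ * ∫ z in A, f z ∂P := by
    rw [ProbabilityTheory.cond, integral_smul_measure, ENNReal.toReal_inv]
    rfl
  set D : Set (ι → Z) :=
    {v | Fintype.card ι * ε ≤ |∑ i, (f (v i) - ∫ z, f z ∂P[|A])|}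
  have hDm : MeasurableSet D := by
    refine measurableSet_le measurable_const (Measurable.abs ?_)
    exact Finset.measurable_sum _ fun i _ => (hf.comp (measurable_pi_apply i)).sub_const _
  have hsub : {v : ι → Z | (∀ i, v i ∈ A) ∧
      ε * P.real A < |∫ z in A, (f z - (∑ i, f (v i)) / Fintype.card ι) ∂P|} ⊆
      D ∩ Set.univ.pi fun _ => A := by
    rintro v ⟨hv, hdev⟩
    refine ⟨?_, by simpa using hv⟩
    rw [integral_sub hfP.integrableOn (integrable_const _), setIntegral_const, smul_eq_mul] at hdev
    -- The integrated deviation is the centred sum scaled by `P(A)/N`, which turns the hypothesis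
    -- into Hoeffding's event.
    have e : ∫ z in A, f z ∂P - P.real A * ((∑ i, f (v i)) / Fintype.card ι) =
        -(P.real A / Fintype.card ι) * ∑ i, (f (v i) - ∫ z, f z ∂P[|A]) := by
      rw [hmean, Finset.sum_sub_distrib, Finset.sum_const, Finset.card_univ, nsmul_eq_mul]
      field_simp
      ring
    rw [e, abs_mul, abs_neg, abs_of_pos (by positivity)] at hdev
    change Fintype.card ι * ε ≤ _
    have h3 : P.real A * (Fintype.card ι * ε) ≤
        P.real A * |∑ i, (f (v i) - ∫ z, f z ∂P[|A])| := by
      rw [div_mul_eq_mul_div, lt_div_iff₀ hN] at hdev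
      nlinarith
    exact le_of_mul_le_mul_left h3 hpos
  refine (measure_mono hsub).trans ?_
  rw [← Measure.restrict_apply hDm, restrict_pi_eq_smul_pi_cond P h0, Measure.smul_apply, hpi,
    Measure.pi_pi, Finset.prod_const, Finset.card_univ, smul_eq_mul, mul_comm]
  gcongr
  exact measure_pi_abs_sum_sub_ge_le _ hf hf01 hε

end Hoeffding

/-! ### Deviation of a bin mean for a fixed set of inner indices. -/

section BinDeviation

variable {𝒳 : Type*} [MeasurableSpace 𝒳] {n : ℕ}

/-- The scores of the data points. -/
def score (g : Predictor 𝒳) (D : Fin n → 𝒳 × unitInterval) : Fin n → unitInterval :=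
  fun i => g.1 (D i).1

/-- The points whose score lies strictly between `a` and `c`. -/
def band (g : Predictor 𝒳) (a c : unitInterval) : Set (𝒳 × unitInterval) :=
  {z | g.1 z.1 ∈ Set.Ioo a c}

/-- The mean label of the band between `a` and `c` differs from `m` by more than `ε`. -/
def Deviates (P : Measure (𝒳 × unitInterval)) (g : Predictor 𝒳) (ε : ℝ) (a c : unitInterval)
    (m : ℝ) : Prop :=
  ε * P.real (band g a c) < |∫ z in band g a c, ((z.2 : ℝ) - m) ∂P|

theorem measurable_score (g : Predictor 𝒳) :
    Measurable fun D : Fin n → 𝒳 × unitInterval => score g D :=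
  measurable_pi_lambda _ fun i => g.2.comp (measurable_fst.comp (measurable_pi_apply i))

theorem measurableSet_band (g : Predictor 𝒳) (a c : unitInterval) :
    MeasurableSet (band g a c) :=
  (g.2.comp measurable_fst) measurableSet_Ioo

theorem measurable_label : Measurable fun z : 𝒳 × unitInterval => (z.2 : ℝ) :=
  measurable_subtype_coe.comp measurable_snd

/-- Mass and integral over the band are section integrals of jointly measurable functions. Tonelli's
theorem below needs this measurability. -/
theorem measurableSet_deviates {Ω : Type*} [MeasurableSpace Ω] (P : Measure (𝒳 × unitInterval))
    [IsProbabilityMeasure P] (g : Predictor 𝒳) (ε : ℝ) {a c : Ω → unitInterval} {m : Ω → ℝ}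
    (ha : Measurable a) (hc : Measurable c) (hm : Measurable m) :
    MeasurableSet {ω | Deviates P g ε (a ω) (c ω) (m ω)} := by
  have hS : MeasurableSet {p : Ω × (𝒳 × unitInterval) | p.2 ∈ band g (a p.1) (c p.1)} := by
    have hg : Measurable fun p : Ω × (𝒳 × unitInterval) => g.1 p.2.1 :=
      g.2.comp (measurable_fst.comp measurable_snd)
    have h1 := measurableSet_lt (ha.comp measurable_fst) hg
    have h2 := measurableSet_lt hg (hc.comp measurable_fst)
    exact h1.inter h2
  have hP : Measurable fun ω => P.real (band g (a ω) (c ω)) :=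
    (measurable_measure_prodMk_left hS).ennreal_toReal
  have hI : Measurable fun ω => ∫ z in band g (a ω) (c ω), ((z.2 : ℝ) - m ω) ∂P := by
    have h1 : Measurable ({p : Ω × (𝒳 × unitInterval) | p.2 ∈ band g (a p.1) (c p.1)}.indicator
        fun p => ((p.2.2 : ℝ) - m p.1)) :=
      ((measurable_label.comp measurable_snd).sub (hm.comp measurable_fst)).indicator hS
    have h2 := h1.stronglyMeasurable.integral_prod_right' (ν := P)
    simp_rw [← integral_indicator (measurableSet_band g _ _)]
    exact h2.measurable
  exact measurableSet_lt (measurable_const.mul hP) hI.abs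

theorem measurableSet_enclosed (g : Predictor 𝒳) (l u : ℕ) (T : Finset (Fin n)) :
    MeasurableSet {D : Fin n → 𝒳 × unitInterval | Enclosed l u T (score g D)} := by
  have hs (k : Fin n) : Measurable fun D : Fin n → 𝒳 × unitInterval => score g D k :=
    (measurable_pi_apply k).comp (measurable_score g)
  have ho (i : ℕ) : Measurable fun D : Fin n → 𝒳 × unitInterval => orderStat (score g D) i :=
    (measurable_orderStat i).comp (measurable_score g)
  have : {D : Fin n → 𝒳 × unitInterval | Enclosed l u T (score g D)} =
      ⋂ k ∈ T, {D | orderStat (score g D) l < score g D k ∧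
        score g D k < orderStat (score g D) u} := by
    ext D
    simp [Enclosed]
  rw [this]
  refine Finset.measurableSet_biInter _ fun k _ => ?_
  have h1 := measurableSet_lt (ho l) (hs k)
  have h2 := measurableSet_lt (hs k) (ho u)
  exact h1.inter h2

/-- Conditionally on the points outside `T`, and on the points in `T` being the inner points
of a bin, the latter are independent draws from `P` restricted to that bin. -/
theorem dataLaw_enclosed_deviates_le (P : Measure (𝒳 × unitInterval)) [IsProbabilityMeasure P]
    (g : Predictor 𝒳) {ε : ℝ} (hε : 0 ≤ ε) {l u : ℕ} (hl : l ≤ n) (hu : 1 ≤ u)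
    {T : Finset (Fin n)} (hT : T.Nonempty) :
    dataLaw P n {D | Enclosed l u T (score g D) ∧ Deviates P g ε (orderStat (score g D) l)
        (orderStat (score g D) u) ((∑ k ∈ T, ((D k).2 : ℝ)) / T.card)} ≤
      ENNReal.ofReal (2 * Real.exp (-2 * T.card * ε ^ 2)) *
        dataLaw P n {D | Enclosed l u T (score g D)} := by
  have ho (i : ℕ) : Measurable fun D : Fin n → 𝒳 × unitInterval => orderStat (score g D) i :=
    (measurable_orderStat i).comp (measurable_score g)
  set F : Set (Fin n → 𝒳 × unitInterval) := {D | Enclosed l u T (score g D)}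
  have hFm : MeasurableSet F := measurableSet_enclosed g l u T
  set G : Set (Fin n → 𝒳 × unitInterval) := {D | Enclosed l u T (score g D) ∧
    Deviates P g ε (orderStat (score g D) l) (orderStat (score g D) u)
      ((∑ k ∈ T, ((D k).2 : ℝ)) / T.card)}
  have hGm : MeasurableSet G :=
    hFm.inter (measurableSet_deviates P g ε (ho l) (ho u)
      ((Finset.measurable_sum _ fun k _ => measurable_label.comp
        (measurable_pi_apply k)).div_const _))
  have : Nonempty {i // i ∈ T} := hT.to_subtype
  let e := MeasurableEquiv.piEquivPiSubtypeProd (fun _ : Fin n => 𝒳 × unitInterval) (· ∈ T)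
  have hmp := (measurePreserving_piEquivPiSubtypeProd (fun _ : Fin n => P) (· ∈ T)).symm
  have hin (v : {i // i ∈ T} → 𝒳 × unitInterval) (w : {i // i ∉ T} → 𝒳 × unitInterval)
      (k : Fin n) (hk : k ∈ T) : e.symm (v, w) k = v ⟨k, hk⟩ := by
    simp [e, MeasurableEquiv.piEquivPiSubtypeProd, Equiv.piEquivPiSubtypeProd, hk]
  have hout (v : {i // i ∈ T} → 𝒳 × unitInterval) (w : {i // i ∉ T} → 𝒳 × unitInterval)
      (k : Fin n) (hk : k ∉ T) : e.symm (v, w) k = w ⟨k, hk⟩ := by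
    simp [e, MeasurableEquiv.piEquivPiSubtypeProd, Equiv.piEquivPiSubtypeProd, hk]
  have hprod (S : Set (Fin n → 𝒳 × unitInterval)) (hS : MeasurableSet S) :
      dataLaw P n S = ∫⁻ w, Measure.pi (fun _ : {i // i ∈ T} => P) {v | e.symm (v, w) ∈ S}
        ∂(Measure.pi fun _ : {i // i ∉ T} => P) := by
    rw [dataLaw, ← hmp.measure_preimage hS.nullMeasurableSet,
      Measure.prod_apply_symm (e.symm.measurable hS)]
    congr!
  have hslice : Measurable fun w => Measure.pi (fun _ : {i // i ∈ T} => P)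
      {v | e.symm (v, w) ∈ F} := measurable_measure_prodMk_right (e.symm.measurable hFm)
  rw [hprod G hGm, hprod F hFm, ← lintegral_const_mul _ hslice]
  refine lintegral_mono fun w => ?_
  -- A slice that admits no enclosed configuration contributes nothing. Otherwise any `v₀` serves as
  -- reference, and its edges are those of the whole slice.
  by_cases hne : ∃ v₀, e.symm (v₀, w) ∈ F
  swap
  · refine (measure_mono_null (t := ∅) (fun v hv => ?_) measure_empty).trans_le zero_le
    exact hne ⟨v, hv.1⟩
  obtain ⟨v₀, hv₀⟩ := hne
  set s₀ := score g (e.symm (v₀, w)) with hs₀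
  have hoff (v : {i // i ∈ T} → 𝒳 × unitInterval) :
      ∀ k ∉ T, score g (e.symm (v, w)) k = s₀ k := by
    intro k hk
    rw [hs₀, score, score, hout _ _ k hk, hout _ _ k hk]
  -- Within the slice, enclosure is a product event with a fixed band.
  have hFeq : {v | e.symm (v, w) ∈ F} =
      {v | ∀ i, v i ∈ band g (orderStat s₀ l) (orderStat s₀ u)} := by
    ext v
    constructor
    · intro hv i
      have h := hv i.1 i.2
      obtain ⟨h1, h2⟩ := Enclosed.orderStat_eq hv₀ hv (hoff v) hl hu
      rwa [h1, h2, score, hin _ _ _ i.2] at h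
    · intro hv
      refine Enclosed.of_forall_mem hv₀ (hoff v) hl hu fun k hk => ?_
      rw [score, hin _ _ _ hk]
      exact hv ⟨k, hk⟩
  have key := measure_pi_inter_deviation_le (ι := {i // i ∈ T}) P measurable_label
    (fun z => z.2.2) (A := band g (orderStat s₀ l) (orderStat s₀ u)) hε
  rw [Fintype.card_coe] at key
  rw [hFeq]
  refine (measure_mono fun v hv => ?_).trans key
  have hvF : e.symm (v, w) ∈ F := hv.1
  obtain ⟨h1, h2⟩ := Enclosed.orderStat_eq hv₀ hvF (hoff v) hl hu
  have hv2 := hv.2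
  have hsum : ∑ k ∈ T, ((e.symm (v, w) k).2 : ℝ) = ∑ i, ((v i).2 : ℝ) := by
    rw [← Finset.sum_coe_sort T]
    exact Finset.sum_congr rfl fun i _ => by rw [hin _ _ _ i.2]
  rw [h1, h2, hsum] at hv2
  exact ⟨(Set.ext_iff.1 hFeq v).1 hvF, hv2⟩

end BinDeviation

/-! ### Almost sure absence of ties. -/

section NoTies

variable {𝒳 : Type*} [MeasurableSpace 𝒳] {n : ℕ}

/-- This is all that is drawn from absolute continuity: the score has no atoms. -/
theorem measure_score_eq (P : Measure (𝒳 × unitInterval)) (g : Predictor 𝒳)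
    (hac : P.map (fun z => (g.1 z.1 : ℝ)) ≪ volume) (t : unitInterval) :
    P {z | g.1 z.1 = t} = 0 := by
  have hg : Measurable fun z : 𝒳 × unitInterval => (g.1 z.1 : ℝ) :=
    measurable_subtype_coe.comp (g.2.comp measurable_fst)
  have h := hac (Real.volume_singleton (a := (t : ℝ)))
  rw [Measure.map_apply hg (measurableSet_singleton _)] at h
  refine measure_mono_null (fun z hz => ?_) h
  exact congrArg Subtype.val hz

theorem ae_score_ne (P : Measure (𝒳 × unitInterval)) [IsProbabilityMeasure P] (g : Predictor 𝒳)
    (hac : P.map (fun z => (g.1 z.1 : ℝ)) ≪ volume) (t : unitInterval) :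
    ∀ᵐ D ∂dataLaw P n, ∀ k, score g D k ≠ t := by
  rw [ae_all_iff]
  intro k
  have h : ∀ᵐ z ∂P, g.1 z.1 ≠ t := by
    rw [ae_iff]
    simpa using measure_score_eq P g hac t
  exact (Measure.quasiMeasurePreserving_eval (fun _ : Fin n => P) k).ae h

/-- Two scores are independent, and each section of the diagonal is a single point, which is null.
-/
theorem ae_injective_score (P : Measure (𝒳 × unitInterval)) [IsProbabilityMeasure P]
    (g : Predictor 𝒳) (hac : P.map (fun z => (g.1 z.1 : ℝ)) ≪ volume) :
    ∀ᵐ D ∂dataLaw P n, Function.Injective (score g D) := by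
  have hg : Measurable fun z : 𝒳 × unitInterval => g.1 z.1 := g.2.comp measurable_fst
  have hs (k : Fin n) : Measurable fun D : Fin n → 𝒳 × unitInterval => score g D k :=
    (measurable_pi_apply k).comp (measurable_score g)
  have hpair : ∀ i j : Fin n, i ≠ j → ∀ᵐ D ∂dataLaw P n, score g D i ≠ score g D j := by
    intro i j hij
    have hind : IndepFun (fun D : Fin n → 𝒳 × unitInterval => score g D i)
        (fun D => score g D j) (dataLaw P n) :=
      (iIndepFun_pi (μ := fun _ : Fin n => P) (X := fun _ z => g.1 z.1)
        fun _ => hg.aemeasurable).indepFun hij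
    have : IsProbabilityMeasure (dataLaw P n) := by
      unfold dataLaw; infer_instance
    rw [indepFun_iff_map_prod_eq_prod_map_map (hs i).aemeasurable (hs j).aemeasurable] at hind
    have hmap : (dataLaw P n).map (fun D => score g D j) = P.map fun z => g.1 z.1 := by
      have hmp := measurePreserving_eval (fun _ : Fin n => P) j
      rw [show (fun D : Fin n → 𝒳 × unitInterval => score g D j) =
        (fun z => g.1 z.1) ∘ Function.eval j from rfl, ← Measure.map_map hg hmp.measurable]
      exact congrArg _ hmp.map_eq
    have hd : MeasurableSet {p : unitInterval × unitInterval | p.1 = p.2} :=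
      measurableSet_eq_fun measurable_fst measurable_snd
    have hz : ((dataLaw P n).map fun D => (score g D i, score g D j))
        {p | p.1 = p.2} = 0 := by
      have : IsProbabilityMeasure ((dataLaw P n).map fun D => score g D j) :=
        Measure.isProbabilityMeasure_map (hs j).aemeasurable
      rw [hind, Measure.measure_prod_null hd]
      refine ae_of_all _ fun x => ?_
      beta_reduce
      rw [hmap, Measure.map_apply hg (measurable_prodMk_left hd)]
      refine measure_mono_null (fun z hz => ?_) (measure_score_eq P g hac x)
      exact Eq.symm hz
    rw [Measure.map_apply ((hs i).prodMk (hs j)) hd] at hz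
    rw [ae_iff]
    simpa using hz
  have hall : ∀ᵐ D ∂dataLaw P n, ∀ i j : Fin n, i ≠ j → score g D i ≠ score g D j := by
    rw [ae_all_iff]
    intro i
    rw [ae_all_iff]
    intro j
    by_cases hij : i = j
    · simp [hij]
    · filter_upwards [hpair i j hij] with D hD _ using hD
  filter_upwards [hall] with D hD i j hij
  by_contra hne
  exact hD i j hne hij

end NoTies

/-! ### Deviation of a bin mean, over all sets of inner indices. -/

section BinBound

variable {𝒳 : Type*} [MeasurableSpace 𝒳] {n : ℕ}

/-- The mean label of the points whose rank is strictly between `l` and `u` rarely deviates from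
the mean label of the population between the corresponding order statistics. -/
theorem dataLaw_deviates_le (P : Measure (𝒳 × unitInterval)) [IsProbabilityMeasure P]
    (g : Predictor 𝒳) (hac : P.map (fun z => (g.1 z.1 : ℝ)) ≪ volume) {ε : ℝ} (hε : 0 ≤ ε)
    {l u : ℕ} (hlu : l + 1 < u) (hu : u ≤ n + 1) :
    dataLaw P n {D | Deviates P g ε (orderStat (score g D) l) (orderStat (score g D) u)
        ((∑ i ∈ ranksBetween n l u, ((D (Tuple.sort (score g D) i)).2 : ℝ)) /
          (ranksBetween n l u).card)} ≤
      ENNReal.ofReal (2 * Real.exp (-2 * (ranksBetween n l u).card * ε ^ 2)) := by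
  set N := (ranksBetween n l u).card with hN
  have hN1 : 1 ≤ N := by
    rw [hN, card_ranksBetween hu]
    omega
  have : IsProbabilityMeasure (dataLaw P n) := by
    unfold dataLaw; infer_instance
  set δ := ENNReal.ofReal (2 * Real.exp (-2 * N * ε ^ 2))
  set F : Finset (Fin n) → Set (Fin n → 𝒳 × unitInterval) :=
    fun T => {D | Enclosed l u T (score g D)}
  set G : Finset (Fin n) → Set (Fin n → 𝒳 × unitInterval) :=
    fun T => {D | Enclosed l u T (score g D) ∧ Deviates P g ε (orderStat (score g D) l)
      (orderStat (score g D) u) ((∑ k ∈ T, ((D k).2 : ℝ)) / T.card)}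
  set 𝒯 := (Finset.univ : Finset (Fin n)).powersetCard N with h𝒯
  -- Without ties and scores at 0 or 1, the indices with inner ranks form an enclosed set `T`.
  have hcover : {D | Deviates P g ε (orderStat (score g D) l) (orderStat (score g D) u)
      ((∑ i ∈ ranksBetween n l u, ((D (Tuple.sort (score g D) i)).2 : ℝ)) / N)}
      ≤ᵐ[dataLaw P n] (⋃ T ∈ 𝒯, G T : Set (Fin n → 𝒳 × unitInterval)) := by
    filter_upwards [ae_injective_score P g hac, ae_score_ne P g hac 0, ae_score_ne P g hac 1]
      with D hinj h0 h1 hD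
    refine Set.mem_biUnion (x := (ranksBetween n l u).map (Tuple.sort (score g D)).toEmbedding)
      ?_ ⟨enclosed_map_sort hinj h0 h1 hu, ?_⟩
    · simp [h𝒯, Finset.mem_powersetCard, hN]
    · rw [Finset.sum_map, Finset.card_map, ← hN]
      exact hD
  have hdisj : Set.PairwiseDisjoint (𝒯 : Set (Finset (Fin n))) F := by
    intro T hT T' hT' hne
    refine Set.disjoint_left.2 fun D hD hD' => hne ?_
    rw [Finset.mem_coe, Finset.mem_powersetCard] at hT hT'
    rw [Enclosed.eq_map_sort hD hT.2, ← Enclosed.eq_map_sort hD' hT'.2]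
  calc _ ≤ dataLaw P n (⋃ T ∈ 𝒯, G T) := measure_mono_ae hcover
    _ ≤ ∑ T ∈ 𝒯, dataLaw P n (G T) := measure_biUnion_finset_le _ _
    _ ≤ ∑ T ∈ 𝒯, δ * dataLaw P n (F T) := by
      refine Finset.sum_le_sum fun T hT => ?_
      rw [h𝒯, Finset.mem_powersetCard] at hT
      have h := dataLaw_enclosed_deviates_le (n := n) P g hε (l := l) (u := u) (by omega)
        (by omega) (T := T) (Finset.card_pos.1 (by omega))
      refine h.trans_eq ?_
      rw [hT.2]
    -- Disjointness keeps the total mass at most one, so the number of sets `T` does not enter.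
    _ = δ * dataLaw P n (⋃ T ∈ 𝒯, F T) := by
      rw [← Finset.mul_sum, measure_biUnion_finset hdisj fun T _ => measurableSet_enclosed g l u T]
    _ ≤ δ * 1 := by gcongr; exact prob_le_one
    _ = δ := mul_one _

end BinBound

/-! ### Arithmetic of the cut ranks. -/

section Cuts

theorem cut_zero (n B : ℕ) : cut n B 0 = 0 := by
  simp [cut]

theorem cut_last (n : ℕ) {B : ℕ} (hB : 1 ≤ B) : cut n B B = n + 1 := by
  have : (B : ℝ) ≠ 0 := by positivity
  rw [cut, mul_div_cancel₀ _ this]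
  exact_mod_cast Nat.ceil_natCast (R := ℝ) (n + 1)

/-- An integer moves through the ceiling, and `⌊n/B⌋ ≤ (n + 1)/B`. So a bin has at least `⌊n/B⌋ - 1`
ranks strictly inside. -/
theorem cut_add_le_cut_succ (n B b : ℕ) : cut n B b + n / B ≤ cut n B (b + 1) := by
  unfold cut
  rw [← Nat.ceil_add_natCast (by positivity)]
  refine Nat.ceil_mono ?_
  push_cast
  rw [add_one_mul]
  gcongr
  refine Nat.cast_div_le.trans ?_
  gcongr
  linarith

theorem cut_le {n B b : ℕ} (hB : 1 ≤ B) (hb : b ≤ B) : cut n B b ≤ n + 1 :=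
  cut_last n hB ▸ cut_mono n B hb

end Cuts

/-! ### From bounds on bins to the regression function and the calibration error. -/

section Calibration

variable {𝒳 : Type*} [MeasurableSpace 𝒳]

theorem comap_predictor_le (h : Predictor 𝒳) :
    MeasurableSpace.comap (fun z : 𝒳 × unitInterval => h.1 z.1) inferInstance ≤
      (inferInstance : MeasurableSpace (𝒳 × unitInterval)) :=
  (h.2.comp measurable_fst).comap_le

theorem integrable_label (P : Measure (𝒳 × unitInterval)) [IsProbabilityMeasure P] :
    Integrable (fun z : 𝒳 × unitInterval => (z.2 : ℝ)) P :=
  Integrable.of_mem_Icc 0 1 measurable_label.aemeasurable (ae_of_all _ fun z => z.2.2)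

theorem measurable_predictor_coe (h : Predictor 𝒳) :
    Measurable fun z : 𝒳 × unitInterval => (h.1 z.1 : ℝ) :=
  measurable_subtype_coe.comp (h.2.comp measurable_fst)

theorem integrable_predictor (P : Measure (𝒳 × unitInterval)) [IsProbabilityMeasure P]
    (h : Predictor 𝒳) : Integrable (fun z : 𝒳 × unitInterval => (h.1 z.1 : ℝ)) P :=
  Integrable.of_mem_Icc 0 1 (measurable_predictor_coe h).aemeasurable
    (ae_of_all _ fun z => (h.1 z.1).2)

/-- A predictor that is constant on each of finitely many bins, which cover almost everything, and
is `ε`-calibrated on each bin, satisfies the calibration bound on all its level sets. -/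
theorem abs_setIntegral_label_sub_le (P : Measure (𝒳 × unitInterval)) [IsProbabilityMeasure P]
    (h : Predictor 𝒳) {ε : ℝ} {B : ℕ} {bin : ℕ → Set (𝒳 × unitInterval)}
    {m : ℕ → ℝ} (hmeas : ∀ b, MeasurableSet (bin b))
    (hdisj : Set.PairwiseDisjoint (Finset.range B : Set ℕ) bin)
    (hval : ∀ b < B, ∀ z ∈ bin b, (h.1 z.1 : ℝ) = m b)
    (hcover : ∀ᵐ z ∂P, ∃ b < B, z ∈ bin b)
    (hbin : ∀ b < B, |∫ z in bin b, ((z.2 : ℝ) - m b) ∂P| ≤ ε * P.real (bin b))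
    {R : Set unitInterval} (hR : MeasurableSet R) :
    |∫ z in {z | h.1 z.1 ∈ R}, ((z.2 : ℝ) - h.1 z.1) ∂P| ≤ ε * P.real {z | h.1 z.1 ∈ R} := by
  set S : Set (𝒳 × unitInterval) := {z | h.1 z.1 ∈ R}
  have hS : MeasurableSet S := (h.2.comp measurable_fst) hR
  have hint : Integrable (fun z : 𝒳 × unitInterval => (z.2 : ℝ) - h.1 z.1) P :=
    (integrable_label P).sub (integrable_predictor P h)
  have hSm (b : ℕ) : MeasurableSet (S ∩ bin b) := hS.inter (hmeas b)
  have hd : Set.PairwiseDisjoint (Finset.range B : Set ℕ) fun b => S ∩ bin b :=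
    hdisj.mono fun b => Set.inter_subset_right
  have hSae : S =ᵐ[P] (⋃ b ∈ Finset.range B, S ∩ bin b : Set (𝒳 × unitInterval)) := by
    refine Filter.eventuallyEq_set.2 ?_
    filter_upwards [hcover] with z hz
    simp only [Set.mem_iUnion, Finset.mem_range, Set.mem_inter_iff, exists_prop]
    constructor
    · intro hzS
      obtain ⟨b, hb, hzb⟩ := hz
      exact ⟨b, hb, hzS, hzb⟩
    · rintro ⟨_, _, hzS, _⟩
      exact hzS
  have hterm : ∀ b ∈ Finset.range B, |∫ z in S ∩ bin b, ((z.2 : ℝ) - h.1 z.1) ∂P| ≤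
      ε * P.real (S ∩ bin b) := by
    intro b hb
    rw [Finset.mem_range] at hb
    rcases Set.eq_empty_or_nonempty (S ∩ bin b) with he | ⟨z₀, hz₀S, hz₀⟩
    · simp [he]
    -- `h` is constant on a bin, so a bin that meets `S` lies in `S`.
    · have hsub : bin b ⊆ S := by
        intro z hz
        have : h.1 z.1 = h.1 z₀.1 := Subtype.ext ((hval b hb z hz).trans (hval b hb z₀ hz₀).symm)
        change h.1 z.1 ∈ R
        rw [this]
        exact hz₀S
      rw [Set.inter_eq_right.2 hsub, setIntegral_congr_fun (g := fun z => (z.2 : ℝ) - m b) (hmeas b)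
        fun z hz => by simp only [hval b hb z hz]]
      exact hbin b hb
  rw [setIntegral_congr_set hSae, measureReal_congr hSae,
    integral_biUnion_finset _ (fun b _ => hSm b) hd fun b _ => hint.integrableOn,
    measureReal_biUnion_finset hd fun b _ => hSm b, Finset.mul_sum]
  exact (Finset.abs_sum_le_sum_abs _ _).trans (Finset.sum_le_sum hterm)

/-- Over sets of `σ(h(X))` the conditional expectation integrates like `Y`. On the trimmed measure
these are all the measurable sets, so integral bounds yield almost sure bounds. -/
theorem ae_abs_condLabel_sub_le (P : Measure (𝒳 × unitInterval)) [IsProbabilityMeasure P]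
    (h : Predictor 𝒳) {ε : ℝ}
    (hlev : ∀ R : Set unitInterval, MeasurableSet R →
      |∫ z in {z | h.1 z.1 ∈ R}, ((z.2 : ℝ) - h.1 z.1) ∂P| ≤ ε * P.real {z | h.1 z.1 ∈ R}) :
    ∀ᵐ z ∂P, |condLabel P h z - (h.1 z.1 : ℝ)| ≤ ε := by
  have hle := comap_predictor_le h
  set 𝓜 := MeasurableSpace.comap (fun z : 𝒳 × unitInterval => h.1 z.1) inferInstance
  set f : 𝒳 × unitInterval → ℝ := fun z => condLabel P h z - h.1 z.1 with hf
  have hHm : StronglyMeasurable[𝓜] fun z : 𝒳 × unitInterval => (h.1 z.1 : ℝ) :=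
    (measurable_subtype_coe.comp (comap_measurable _)).stronglyMeasurable
  have hfm : StronglyMeasurable[𝓜] f := stronglyMeasurable_condExp.sub hHm
  have hκ : Integrable (condLabel P h) P := integrable_condExp
  have hfi : Integrable f P := hκ.sub (integrable_predictor P h)
  have hft : Integrable f (P.trim hle) := hfi.trim hle hfm
  have hset : ∀ S, MeasurableSet[𝓜] S → |∫ z in S, f z ∂P.trim hle| ≤ ε * P.real S := by
    intro S hS
    rw [← setIntegral_trim hle hfm hS]
    have hS' : ∫ z in S, f z ∂P = ∫ z in S, ((z.2 : ℝ) - h.1 z.1) ∂P := by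
      rw [hf, integral_sub hκ.integrableOn (integrable_predictor P h).integrableOn,
        integral_sub (integrable_label P).integrableOn (integrable_predictor P h).integrableOn]
      congr 1
      exact setIntegral_condExp hle (integrable_label P) hS
    rw [hS']
    obtain ⟨R, hR, rfl⟩ := hS
    exact hlev R hR
  have : IsFiniteMeasure (P.trim hle) := isFiniteMeasure_trim hle
  have hconst (c : ℝ) (S : Set (𝒳 × unitInterval)) (hS : MeasurableSet[𝓜] S) :
      ∫ _z in S, c ∂P.trim hle = c * P.real S := by
    rw [setIntegral_const, smul_eq_mul, mul_comm, measureReal_def, trim_measurableSet_eq hle hS]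
    rfl
  have hup : f ≤ᵐ[P.trim hle] fun _ => ε := by
    refine ae_le_of_forall_setIntegral_le hft (integrable_const _) fun S hS _ => ?_
    rw [hconst ε S hS]
    exact (abs_le.1 (hset S hS)).2
  have hlo : (fun _ => -ε) ≤ᵐ[P.trim hle] f := by
    refine ae_le_of_forall_setIntegral_le (integrable_const _) hft fun S hS _ => ?_
    rw [hconst (-ε) S hS, neg_mul]
    exact (abs_le.1 (hset S hS)).1
  filter_upwards [ae_of_ae_trim hle hup, ae_of_ae_trim hle hlo] with z h1 h2
  exact abs_le.2 ⟨h2, h1⟩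

theorem isCalibratedPredictor_of_ae (P : Measure (𝒳 × unitInterval)) (h : Predictor 𝒳) {ε : ℝ}
    (hε : 0 ≤ ε) (hae : ∀ᵐ z ∂P, |condLabel P h z - (h.1 z.1 : ℝ)| ≤ ε) :
    IsCalibratedPredictor P h ε := by
  have hm : Measurable[MeasurableSpace.comap (fun z : 𝒳 × unitInterval => h.1 z.1) inferInstance]
      (condLabel P h) := stronglyMeasurable_condExp.measurable
  obtain ⟨m₀, hm₀, heq⟩ := hm.exists_eq_measurable_comp
  have hc : Measurable fun r : unitInterval => (r : ℝ) := measurable_subtype_coe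
  -- Clamping a version to `[r - ε, r + ε]` changes it only on a null set and makes the bound hold
  -- at every `r`.
  refine ⟨fun r => max (r - ε) (min (m₀ r) (r + ε)), ⟨?_, ?_⟩, fun r _ => ?_⟩
  · exact (hc.sub_const _).max (hm₀.min (hc.add_const _))
  · filter_upwards [hae] with z hz
    rw [heq, Function.comp_apply] at hz ⊢
    rw [abs_le] at hz
    rw [min_eq_left (by linarith), max_eq_right (by linarith)]
  · rw [abs_le]
    constructor
    · linarith [le_max_left ((r : ℝ) - ε) (min (m₀ r) (r + ε))]
    · have : max ((r : ℝ) - ε) (min (m₀ r) (r + ε)) ≤ r + ε :=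
        max_le (by linarith) (min_le_right _ _)
      linarith

theorem ece_le_of_ae (P : Measure (𝒳 × unitInterval)) [IsProbabilityMeasure P] (h : Predictor 𝒳)
    {ε : ℝ} (hε : 0 ≤ ε) (hae : ∀ᵐ z ∂P, |condLabel P h z - (h.1 z.1 : ℝ)| ≤ ε) {p : ℝ}
    (hp : 1 ≤ p) : ece P p h ≤ ENNReal.ofReal ε := by
  have hp0 : 0 < p := by linarith
  have h1 : ∫⁻ z, ENNReal.ofReal (|condLabel P h z - (h.1 z.1 : ℝ)| ^ p) ∂P ≤
      ENNReal.ofReal ε ^ p := by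
    rw [ENNReal.ofReal_rpow_of_nonneg hε hp0.le]
    refine (lintegral_mono_ae (g := fun _ => ENNReal.ofReal (ε ^ p)) ?_).trans (by simp)
    filter_upwards [hae] with z hz
    gcongr
  calc ece P p h ≤ (ENNReal.ofReal ε ^ p) ^ (1 / p) := by
        unfold ece
        gcongr
    _ = ENNReal.ofReal ε := by
        rw [← ENNReal.rpow_mul, mul_one_div_cancel hp0.ne', ENNReal.rpow_one]

end Calibration

/-! ### The binned predictor outside the bad event. -/

section Binning

variable {n : ℕ}

theorem exists_mem_Ico_of_le_of_lt {a : ℕ → unitInterval} {t : unitInterval} (h0 : a 0 ≤ t)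
    {B : ℕ} (hB : t < a B) : ∃ b < B, a b ≤ t ∧ t < a (b + 1) := by
  induction B with
  | zero => exact absurd (hB.trans_le h0) (lt_irrefl _)
  | succ B ih =>
    rcases lt_or_ge t (a B) with h | h
    · obtain ⟨b, hb, hab⟩ := ih h
      exact ⟨b, by omega, hab⟩
    · exact ⟨B, by omega, h, hB⟩

/-- The scores of bin `b`. -/
def binInterval (B : ℕ) (s : Fin n → unitInterval) (b : ℕ) : Set unitInterval :=
  Set.Ico (orderStat s (cut n B b)) (orderStat s (cut n B (b + 1)))

theorem pairwise_disjoint_binInterval (B : ℕ) (s : Fin n → unitInterval) :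
    Pairwise (Function.onFun Disjoint (binInterval B s)) :=
  ((orderStat_mono s).comp (cut_mono n B)).pairwise_disjoint_on_Ico_succ

theorem binnedValue_eq_binMean {B : ℕ} (s y : Fin n → unitInterval) {t : unitInterval} {b : ℕ}
    (hb : b < B) (ht : t ∈ binInterval B s b) : binnedValue B s y t = binMean B s y b := by
  unfold binnedValue
  rw [Finset.sum_eq_single_of_mem b (Finset.mem_range.2 hb)]
  · exact if_pos ht
  · intro c _ hcb
    exact if_neg fun hc => Set.disjoint_left.1 (pairwise_disjoint_binInterval B s hcb) hc ht

variable {𝒳 : Type*} [MeasurableSpace 𝒳]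

theorem ae_abs_condLabel_umd_sub_le (P : Measure (𝒳 × unitInterval)) [IsProbabilityMeasure P]
    (g : Predictor 𝒳) (hac : P.map (fun z => (g.1 z.1 : ℝ)) ≪ volume) {B : ℕ} (hB : 1 ≤ B) {ε : ℝ}
    {D : Fin n → 𝒳 × unitInterval}
    (hD : ∀ b < B, ¬ Deviates P g ε (orderStat (score g D) (cut n B b))
      (orderStat (score g D) (cut n B (b + 1))) (binMean B (score g D) (fun i => (D i).2) b)) :
    ∀ᵐ z ∂P, |condLabel P (umd n B g D) z - ((umd n B g D).1 z.1 : ℝ)| ≤ ε := by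
  have hne (t : unitInterval) : ∀ᵐ z ∂P, g.1 z.1 ≠ t := by
    rw [ae_iff]
    simpa using measure_score_eq P g hac t
  -- A bin contains its left edge and the band does not; the difference is null.
  have hband (b : ℕ) : {z : 𝒳 × unitInterval | g.1 z.1 ∈ binInterval B (score g D) b} =ᵐ[P]
      band g (orderStat (score g D) (cut n B b)) (orderStat (score g D) (cut n B (b + 1))) := by
    refine Filter.eventuallyEq_set.2 ?_
    filter_upwards [hne (orderStat (score g D) (cut n B b))] with z hz
    exact ⟨fun h => ⟨lt_of_le_of_ne h.1 hz.symm, h.2⟩, fun h => ⟨h.1.le, h.2⟩⟩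
  refine ae_abs_condLabel_sub_le P _ fun R hR =>
    abs_setIntegral_label_sub_le P _ (B := B)
      (bin := fun b => {z | g.1 z.1 ∈ binInterval B (score g D) b})
      (m := fun b => binMean B (score g D) (fun i => (D i).2) b)
      (fun b => (g.2.comp measurable_fst) measurableSet_Ico) ?_ ?_ ?_ ?_ hR
  · intro b _ c _ hbc
    exact (pairwise_disjoint_binInterval B (score g D) hbc).preimage
      fun z : 𝒳 × unitInterval => g.1 z.1
  · intro b hb z hz
    exact binnedValue_eq_binMean _ _ hb hz
  -- The half-open bins together miss only the score 1.
  · filter_upwards [hne 1] with z hz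
    refine exists_mem_Ico_of_le_of_lt (a := fun b => orderStat (score g D) (cut n B b)) ?_ ?_
    · simp only [cut_zero, orderStat_zero]
      exact bot_le
    · simp only [cut_last n hB, orderStat_eq_one _ (Nat.lt_succ_self n)]
      exact lt_of_le_of_ne le_top hz
  · intro b hb
    rw [setIntegral_congr_set (hband b), measureReal_congr (hband b)]
    exact not_lt.1 (hD b hb)

end Binning

/-! ### Union bound over the bins and conclusion. -/

theorem withProbAtLeast_of_measure_le {Ω : Type*} [MeasurableSpace Ω] {μ : Measure Ω}
    [IsProbabilityMeasure μ] {α : ℝ} (hα : 0 ≤ α) {U : Set Ω} (hU : μ U ≤ ENNReal.ofReal α)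
    {Q : Ω → Prop} (hQ : ∀ ω ∉ U, Q ω) : WithProbAtLeast μ (1 - α) Q := by
  -- The measurable hull has the same measure as `U`, so measurability of `U` is not required.
  refine ⟨(toMeasurable μ U)ᶜ, (measurableSet_toMeasurable μ U).compl, ?_,
    fun ω hω => hQ ω fun h => hω (subset_toMeasurable μ U h)⟩
  rw [prob_compl_eq_one_sub (measurableSet_toMeasurable μ U), measure_toMeasurable,
    ENNReal.ofReal_sub _ hα, ENNReal.ofReal_one]
  gcongr

theorem two_mul_exp_le {α ε : ℝ} {B M N : ℕ} (hα₀ : 0 < α) (hα₁ : α < 1) (hB : 1 ≤ B)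
    (hM : 2 ≤ M) (hN : M ≤ N + 1)
    (hε : ε = Real.sqrt (Real.log (2 * (B : ℝ) / α) / (2 * ((M : ℝ) - 1)))) :
    2 * Real.exp (-2 * N * ε ^ 2) ≤ α / B := by
  have hB' : (1 : ℝ) ≤ B := by exact_mod_cast hB
  have hM' : (2 : ℝ) ≤ M := by exact_mod_cast hM
  have hN' : (M : ℝ) ≤ N + 1 := by exact_mod_cast hN
  have hlog : 0 ≤ Real.log (2 * (B : ℝ) / α) :=
    Real.log_nonneg (by rw [le_div_iff₀ hα₀]; linarith)
  have hM1 : 0 < (M : ℝ) - 1 := by linarith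
  rw [hε, Real.sq_sqrt (by positivity)]
  -- The exponent is `-log(2B/α) · N/(M - 1)`, and `N ≥ M - 1 > 0`.
  have h1 : -2 * (N : ℝ) * (Real.log (2 * (B : ℝ) / α) / (2 * ((M : ℝ) - 1))) ≤
      -Real.log (2 * (B : ℝ) / α) := by
    have e : -2 * (N : ℝ) * (Real.log (2 * (B : ℝ) / α) / (2 * ((M : ℝ) - 1))) =
        -(Real.log (2 * (B : ℝ) / α) * (N / (M - 1))) := by
      field_simp
    rw [e, neg_le_neg_iff]
    exact le_mul_of_one_le_right hlog ((one_le_div hM1).2 (by linarith))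
  calc _ ≤ 2 * Real.exp (-Real.log (2 * (B : ℝ) / α)) := by gcongr
    _ = α / B := by
      rw [Real.exp_neg, Real.exp_log (by positivity)]
      field_simp

theorem measure_exists_deviates_le {𝒳 : Type*} [MeasurableSpace 𝒳] {n B : ℕ} (hB : 1 ≤ B)
    (hn : 2 * B ≤ n) (g : Predictor 𝒳) (P : Measure (𝒳 × unitInterval)) [IsProbabilityMeasure P]
    (hac : P.map (fun z => (g.1 z.1 : ℝ)) ≪ volume) {α : ℝ} (hα₀ : 0 < α) (hα₁ : α < 1) {ε : ℝ}
    (hε : ε = Real.sqrt (Real.log (2 * (B : ℝ) / α) / (2 * (((n / B : ℕ) : ℝ) - 1)))) :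
    dataLaw P n {D | ∃ b < B, Deviates P g ε (orderStat (score g D) (cut n B b))
      (orderStat (score g D) (cut n B (b + 1))) (binMean B (score g D) (fun i => (D i).2) b)} ≤
      ENNReal.ofReal α := by
  have hε0 : 0 ≤ ε := hε ▸ Real.sqrt_nonneg _
  have hM : 2 ≤ n / B := (Nat.le_div_iff_mul_le (by omega)).2 hn
  have hset : {D : Fin n → 𝒳 × unitInterval | ∃ b < B,
      Deviates P g ε (orderStat (score g D) (cut n B b))
        (orderStat (score g D) (cut n B (b + 1))) (binMean B (score g D) (fun i => (D i).2) b)} =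
      ⋃ b ∈ Finset.range B, {D | Deviates P g ε (orderStat (score g D) (cut n B b))
        (orderStat (score g D) (cut n B (b + 1)))
        (binMean B (score g D) (fun i => (D i).2) b)} := by
    ext D
    simp
  rw [hset]
  calc _ ≤ ∑ b ∈ Finset.range B, dataLaw P n {D | Deviates P g ε
        (orderStat (score g D) (cut n B b)) (orderStat (score g D) (cut n B (b + 1)))
        (binMean B (score g D) (fun i => (D i).2) b)} := measure_biUnion_finset_le _ _
    _ ≤ ∑ _b ∈ Finset.range B, ENNReal.ofReal (α / B) := by
      refine Finset.sum_le_sum fun b hb => ?_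
      rw [Finset.mem_range] at hb
      have hgap := cut_add_le_cut_succ n B b
      have hle : cut n B (b + 1) ≤ n + 1 := cut_le hB hb
      refine (dataLaw_deviates_le P g hac hε0 (l := cut n B b) (by omega) hle).trans ?_
      refine ENNReal.ofReal_le_ofReal (two_mul_exp_le hα₀ hα₁ hB hM ?_ hε)
      rw [card_ranksBetween hle]
      omega
    _ = ENNReal.ofReal α := by
      have hB0 : (B : ℝ) ≠ 0 := by positivity
      rw [Finset.sum_const, Finset.card_range, nsmul_eq_mul, ← ENNReal.ofReal_natCast,
        ← ENNReal.ofReal_mul (by positivity), mul_div_cancel₀ _ hB0]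

end UMD

theorem theorem1 {𝒳 : Type*} [MeasurableSpace 𝒳] (n B : ℕ) (hB : 1 ≤ B) (hn : 2 * B ≤ n)
    (g : UMD.Predictor 𝒳) (P : Measure (𝒳 × unitInterval)) [IsProbabilityMeasure P]
    (hac : P.map (fun z => (g.1 z.1 : ℝ)) ≪ volume)
    (α : ℝ) (hα₀ : 0 < α) (hα₁ : α < 1)
    (ε : ℝ) (hε : ε = Real.sqrt (Real.log (2 * (B : ℝ) / α) / (2 * (((n / B : ℕ) : ℝ) - 1)))) :
    UMD.ConditionallyCalibratedAt (UMD.umd n B) g P ε α ∧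
    UMD.WithProbAtLeast (UMD.dataLaw P n) (1 - α) fun D =>
      ∀ p : ℝ, 1 ≤ p → UMD.ece P p (UMD.umd n B g D) ≤ ENNReal.ofReal ε := by
  have hε0 : 0 ≤ ε := hε ▸ Real.sqrt_nonneg _
  have : IsProbabilityMeasure (UMD.dataLaw P n) := by
    unfold UMD.dataLaw; infer_instance
  have hbad := UMD.measure_exists_deviates_le hB hn g P hac hα₀ hα₁ hε
  have hgood (D : Fin n → 𝒳 × unitInterval) (hD : D ∉ {D | ∃ b < B, UMD.Deviates P g ε
      (UMD.orderStat (UMD.score g D) (UMD.cut n B b))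
      (UMD.orderStat (UMD.score g D) (UMD.cut n B (b + 1)))
      (UMD.binMean B (UMD.score g D) (fun i => (D i).2) b)}) :
      ∀ᵐ z ∂P, |UMD.condLabel P (UMD.umd n B g D) z - ((UMD.umd n B g D).1 z.1 : ℝ)| ≤ ε :=
    UMD.ae_abs_condLabel_umd_sub_le P g hac hB fun b hb hdev => hD ⟨b, hb, hdev⟩
  exact ⟨UMD.withProbAtLeast_of_measure_le hα₀.le hbad fun D hD =>
      UMD.isCalibratedPredictor_of_ae P _ hε0 (hgood D hD),
    UMD.withProbAtLeast_of_measure_le hα₀.le hbad fun D hD p hp =>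
      UMD.ece_le_of_ae P _ hε0 (hgood D hD) hp⟩
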